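/- Let $G$ be a totally disconnected, locally compact (Hausdorff) topological group, and let $\mathrm{Aut}(G)$ be the group of its automorphisms as a topological group. Let $H \le \mathrm{Aut}(G)$ be equicontinuously generated: $H = \langle S \rangle$ for some set $S = S^{-1}$ of automorphisms that is equicontinuous on $G$ with respect to the right uniformity, which has basic entourages $\{(x,y) \in G\times G \mid x \in Uy\}$ for $U$ an identity neighbourhood in $G$. A subset $X$ of $G$ is called $H$-invariant if $h(X) = X$ for all $h \in H$. Let $K$ be a closed $H$-invariant subgroup of $G$; then $H$ acts on the coset space $G/K = \{xK \mid x \in G\}$ by $h.xK = h(x)K$. Equip $G/K$ with the quotient topology and with the right uniformity, which has basic entourages $\{(xK,yK) \mid xK \subseteq UyK\}$ for $U$ an identity neighbourhood in $G$. A point $x \in G/K$ is an equicontinuous point if for every entourage $E$ there is a neighbourhood $U$ of $x$ such that $(hx,hy) \in E$ for all $h \in H$ and $y \in U$. It is a distal point if there is no $y \neq x$ for which there exist a net $(h_i)$ in $H$ and $z \in G/K$ with $h_i x \to z$ and $h_i y \to z$. Let $\mathcal{V}$ be the set of open $H$-invariant subgroups of $G$, and let $\mathrm{Res}_G(H) =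 \bigcap_{V \in \mathcal{V}} V$ be the discrete residual. Then the following are equivalent: (i) $H$ acts N-equicontinuously on $G/K$, that is, there is a neighbourhood of the trivial coset in $G/K$ consisting of equicontinuous points; (ii) $H$ acts N-distally on $G/K$, that is, there is a neighbourhood of the trivial coset in $G/K$ consisting of distal points; (iii) there is a neighbourhood $N$ of the trivial coset in $G/K$ such that, for all $x, y \in N$, if $\overline{Hx}$ is compact and $x \in \overline{Hy}$, then $y \in \overline{Hx}$; (iv) $\{VK/K \mid V \in \mathcal{V}\}$ is a base of neighbourhoods of the trivial coset in $G/K$; (v) $K \ge \mathrm{Res}_G(H)$. -/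

import Mathlib

open Set Filter Topology
open scoped Pointwise

namespace CosetDynamics

/-! ### The group of topological automorphisms -/

/-- The group `Aut(G)` of topological group automorphisms of `G`, under composition. -/
instance autGroup (G : Type*) [Group G] [TopologicalSpace G] : Group (G ≃ₜ* G) where
  mul f g := g.trans f
  one := ContinuousMulEquiv.refl G
  inv f := f.symm
  mul_assoc _ _ _ := rfl
  one_mul _ := rfl
  mul_one _ := rfl
  inv_mul_cancel f := by
    ext x
    exact f.symm_apply_apply x

/-- The tautological left action of `Aut(G)` on `G`. -/
instance autAction (G : Type*) [Group G] [TopologicalSpace G] : MulAction (G ≃ₜ* G) G where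
  smul f x := f x
  one_smul _ := rfl
  mul_smul _ _ _ := rfl

section Invariant

variable {G : Type*} [Group G] [TopologicalSpace G]

/-- `X` is `H`-invariant: `h(X) = X` for all `h ∈ H`. -/
def IsInvariant (H : Subgroup (G ≃ₜ* G)) (X : Set G) : Prop :=
  ∀ h ∈ H, (fun x => h x) '' X = X

/-- The discrete residual `Res_G(H)`: the intersection of all open `H`-invariant subgroups. -/
def discreteResidual (H : Subgroup (G ≃ₜ* G)) : Subgroup G :=
  sInf {V : Subgroup G | IsOpen (V : Set G) ∧ IsInvariant H (V : Set G)}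

/-- `H = ⟨S⟩` for some symmetric set `S` of automorphisms which is equicontinuous on `G`
with respect to the right uniformity of `G`. -/
def IsEquicontinuouslyGenerated [IsTopologicalGroup G] (H : Subgroup (G ≃ₜ* G)) : Prop :=
  letI : UniformSpace G := IsTopologicalGroup.rightUniformSpace G
  ∃ S : Set (G ≃ₜ* G), S⁻¹ = S ∧ Subgroup.closure S = H ∧
    Equicontinuous (fun (s : S) (x : G) => (s : G ≃ₜ* G) x)

theorem IsInvariant.quotientAction {H : Subgroup (G ≃ₜ* G)} {K : Subgroup G}
    (hK : IsInvariant H (K : Set G)) : MulAction.QuotientAction H K where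
  inv_mul_mem := by
    rintro ⟨h, hh⟩ a b hab
    have key : h (a⁻¹ * b) ∈ K := by
      have h1 : h (a⁻¹ * b) ∈ (fun x => h x) '' (K : Set G) := ⟨_, hab, rfl⟩
      rw [hK h hh] at h1
      exact h1
    rw [map_mul, map_inv] at key
    exact key

/-- The action of `H` on the coset space `G/K`, for `K` an `H`-invariant subgroup:
`h • xK = h(x)K`. -/
@[reducible] def cosetAction {H : Subgroup (G ≃ₜ* G)} {K : Subgroup G}
    (hK : IsInvariant H (K : Set G)) : MulAction H (G ⧸ K) :=
  letI := hK.quotientAction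
  inferInstance

theorem cosetAction_mk {H : Subgroup (G ≃ₜ* G)} {K : Subgroup G}
    (hK : IsInvariant H (K : Set G)) (h : H) (x : G) :
    (cosetAction hK).toSMul.smul h (x : G ⧸ K) = (((h : G ≃ₜ* G) x : G) : G ⧸ K) :=
  rfl

end Invariant

/-! ### The right uniformity on a coset space -/

section Uniformity

variable {G : Type*} [Group G]

/-- The basic entourage `E_U = {(xK, yK) | xK ⊆ U y K}`, where a coset `p : G ⧸ K` is
seen as a subset of `G` by taking its preimage. -/
def cosetEntourage (K : Subgroup G) (U : Set G) : Set ((G ⧸ K) × (G ⧸ K)) :=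
  {p | ((↑) : G → G ⧸ K) ⁻¹' {p.1} ⊆ U * ((↑) : G → G ⧸ K) ⁻¹' {p.2}}

theorem mk_mem_cosetEntourage {K : Subgroup G} {U : Set G} {x y : G} :
    ((x : G ⧸ K), (y : G ⧸ K)) ∈ cosetEntourage K U ↔ ∃ u ∈ U, ((u * y : G) : G ⧸ K) = x := by
  constructor
  · intro h
    obtain ⟨u, hu, z, hz, huz⟩ := Set.mem_mul.1 (h (show x ∈ _ from rfl))
    refine ⟨u, hu, ?_⟩
    have hz' : (z : G ⧸ K) = y := hz
    rw [← huz, QuotientGroup.eq]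
    rw [eq_comm, QuotientGroup.eq] at hz'
    simpa [mul_assoc] using hz'
  · rintro ⟨u, hu, h⟩ w hw
    have hw' : (w : G ⧸ K) = x := hw
    refine Set.mem_mul.2 ⟨u, hu, u⁻¹ * w, ?_, by group⟩
    show ((u⁻¹ * w : G) : G ⧸ K) = y
    rw [← h, eq_comm, QuotientGroup.eq] at hw'
    rw [eq_comm, QuotientGroup.eq]
    simpa [mul_assoc] using hw'

theorem cosetEntourage_mono (K : Subgroup G) : Monotone (cosetEntourage K) :=
  fun _ _ h _ hp => hp.trans (Set.mul_subset_mul_right h)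

variable [TopologicalSpace G] [IsTopologicalGroup G]

/-- The right uniformity on `G/K`, with basic entourages `E_U` for `U` an identity
neighbourhood in `G`. Its underlying topology is the quotient topology. -/
@[reducible] def cosetRightUniformSpace (K : Subgroup G) : UniformSpace (G ⧸ K) where
  toTopologicalSpace := inferInstance
  uniformity := (𝓝 (1 : G)).lift' (cosetEntourage K)
  symm := by
    rw [Filter.tendsto_lift']
    intro U hU
    have hU' : U⁻¹ ∈ 𝓝 (1 : G) := inv_mem_nhds_one G hU
    filter_upwards [Filter.mem_lift' hU']
    rintro ⟨p, q⟩
    induction p using QuotientGroup.induction_on with | H x => ?_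
    induction q using QuotientGroup.induction_on with | H y => ?_
    intro h
    obtain ⟨u, hu, h⟩ := mk_mem_cosetEntourage.1 h
    refine mk_mem_cosetEntourage.2 ⟨u⁻¹, hu, ?_⟩
    rw [eq_comm, QuotientGroup.eq] at h
    rw [eq_comm, QuotientGroup.eq]
    have := K.inv_mem h
    simpa [mul_assoc] using this
  comp := by
    rw [Filter.le_lift']
    intro U hU
    obtain ⟨V, hV, hVU⟩ := exists_nhds_one_split hU
    refine Filter.mem_of_superset (Filter.mem_lift' (Filter.mem_lift' hV)) ?_
    rintro ⟨p, q⟩ ⟨r, h1, h2⟩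
    induction p using QuotientGroup.induction_on with | H x => ?_
    induction q using QuotientGroup.induction_on with | H y => ?_
    induction r using QuotientGroup.induction_on with | H z => ?_
    obtain ⟨u, hu, h1⟩ := mk_mem_cosetEntourage.1 h1
    obtain ⟨v, hv, h2⟩ := mk_mem_cosetEntourage.1 h2
    refine mk_mem_cosetEntourage.2 ⟨u * v, hVU u hu v hv, ?_⟩
    rw [← h1]
    rw [QuotientGroup.eq] at h2 ⊢
    simpa [mul_assoc] using h2
  nhds_eq_comap_uniformity := by
    intro p
    induction p using QuotientGroup.induction_on with | H x => ?_
    have hx : 𝓝 (x : G ⧸ K) = map (fun u : G => ((u * x : G) : G ⧸ K)) (𝓝 1) := by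
      have h1 : 𝓝 x = map (fun u : G => u * x) (𝓝 1) := (map_mul_right_nhds_one x).symm
      rw [QuotientGroup.nhds_eq, h1, Filter.map_map]
      rfl
    rw [hx]
    ext s
    rw [Filter.mem_map, Filter.mem_comap]
    constructor
    · intro hs
      refine ⟨_, Filter.mem_lift' (inv_mem_nhds_one G hs), ?_⟩
      intro q
      induction q using QuotientGroup.induction_on with | H y => ?_
      intro h
      obtain ⟨u, hu, h⟩ := mk_mem_cosetEntourage.1 h
      have hu' : ((u⁻¹ * x : G) : G ⧸ K) ∈ s := hu
      have : ((u⁻¹ * x : G) : G ⧸ K) = y := by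
        rw [eq_comm, QuotientGroup.eq] at h
        rw [eq_comm, QuotientGroup.eq]
        have := K.inv_mem h
        simpa [mul_assoc] using this
      rwa [← this]
    · rintro ⟨t, ht, hts⟩
      obtain ⟨U, hU, hUt⟩ := (Filter.mem_lift'_sets (cosetEntourage_mono K)).1 ht
      filter_upwards [inv_mem_nhds_one G hU] with u hu
      apply hts
      apply hUt
      refine mk_mem_cosetEntourage.2 ⟨u⁻¹, hu, ?_⟩
      simp

end Uniformity

/-! ### Distal points, N-distal and N-equicontinuous coset actions -/

section Dynamics

/-- `(x, y)` is a proximal pair for the action of `Γ` on `X`: for some `z`, the point `(z, z)`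
is a limit of a net `(g_i x, g_i y)` with `g_i ∈ Γ`. -/
def IsProximalPair (Γ : Type*) {X : Type*} [Group Γ] [MulAction Γ X] [TopologicalSpace X]
    (x y : X) : Prop :=
  ∃ z : X, (z, z) ∈ closure (Set.range fun g : Γ => (g • x, g • y))

/-- `x` is a distal point: no point other than `x` is proximal to `x`. -/
def IsDistalPoint (Γ : Type*) {X : Type*} [Group Γ] [MulAction Γ X] [TopologicalSpace X]
    (x : X) : Prop :=
  ∀ y : X, IsProximalPair Γ x y → y = x

variable {G : Type*} [Group G] [TopologicalSpace G]

/-- The orbit `Hx` of `x ∈ G/K` under `H`. -/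
def cosetOrbit {H : Subgroup (G ≃ₜ* G)} {K : Subgroup G} (hK : IsInvariant H (K : Set G))
    (x : G ⧸ K) : Set (G ⧸ K) :=
  letI := cosetAction hK
  MulAction.orbit H x

/-- `H` acts N-distally on `G/K`: some neighbourhood of the trivial coset consists of
distal points. -/
def ActsNDistally {H : Subgroup (G ≃ₜ* G)} {K : Subgroup G} (hK : IsInvariant H (K : Set G)) :
    Prop :=
  letI := cosetAction hK
  ∃ N ∈ 𝓝 ((1 : G) : G ⧸ K), ∀ x ∈ N, IsDistalPoint H x

/-- `H` acts N-equicontinuously on `G/K`: some neighbourhood of the trivial coset consists of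
equicontinuous points, with respect to the right uniformity on `G/K`. -/
def ActsNEquicontinuously [IsTopologicalGroup G] {H : Subgroup (G ≃ₜ* G)} {K : Subgroup G}
    (hK : IsInvariant H (K : Set G)) : Prop :=
  letI := cosetAction hK
  letI := cosetRightUniformSpace K
  ∃ N ∈ 𝓝 ((1 : G) : G ⧸ K), ∀ x ∈ N, EquicontinuousAt (fun (h : H) (y : G ⧸ K) => h • y) x

end Dynamics

end CosetDynamics

/-!
The implications are proved in a cycle, in the order of the list.

* Equicontinuity near the trivial coset gives distality (`exists_nhds_isDistalPoint`): orbits that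
  start close to this fixed point stay close to it, so limits of translates are again equicontinuous
  points, and two points that move simultaneously to an equicontinuous point coincide.
* Distality gives the recurrence condition on orbit closures
  (`exists_isProximalPair_of_isCompact`): if the orbit of `y` accumulates at a compact invariant
  set, an idempotent ultrafilter on `H` makes `y` proximal to a point of that set; a distal point
  `y` is then equal to it.
* Recurrence gives small open invariant subgroups (`isOpen_setOf_orbit_subset`,
  `exists_isInvariant_subgroup_of_isCompact`): for a small compact open neighbourhood `U` of the
  trivial coset, let `X` be the set of points whose `H`-orbit stays in `U`. If `X` were not open,
  orbits would leave `U` for the first time after arbitrarily long words in the equicontinuous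
  generating set, and compactness would yield a point `y` outside `U` whose orbit closure contains
  a point whose orbit stays in `U`, against recurrence. So `X` is a compact open `H`-invariant set,
  and its stabiliser in `G` is an open `H`-invariant subgroup `V` with `VK/K ⊆ X`.
* Small open invariant subgroups force `Res_G(H) ≤ K`, because `K` is closed.
* Let `R = Res_G(H) ≤ K`. The recurrence condition always holds with `R` in place of `K`, because
  `G/R` embeds into the product of the discrete spaces `G/V`, for `V` an open `H`-invariant subgroup
  (`isNRecurrent_discreteResidual`). Hence `G/R` has small open invariant subgroups, and there is an
  open `H`-invariant subgroup `V₀` contained in `UR` with `U` compact. Such a `V₀` normalises `R`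
  (`conj_mem_discreteResidual`), so the left translations by small open `H`-invariant subgroups
  control the orbits in `V₀K/K`, which gives equicontinuity there.
-/

namespace CosetDynamics

open scoped Uniformity

/-! ### Actions on topological and uniform spaces -/

section Actions

variable {Γ X : Type*} [Group Γ] [MulAction Γ X]

/-- If an orbit closure meets a compact invariant set `C`, then its base point is proximal to a
point of `C`. The ultrafilters `p` on the acting group along which `g • y` converges into `C` form
a closed subsemigroup; for an idempotent `u` in it, `y` and its limit `z` along `u` both move
to `z` along `u`. -/
theorem exists_isProximalPair_of_isCompact [TopologicalSpace X] [T2Space X]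
    [ContinuousConstSMul Γ X] {C : Set X} (hC : IsCompact C) (hinv : ∀ g : Γ, ∀ x ∈ C, g • x ∈ C)
    {x y : X} (hxC : x ∈ C) (hxy : x ∈ closure (MulAction.orbit Γ y)) :
    ∃ z ∈ C, IsProximalPair Γ y z := by
  let _ : Semigroup (Ultrafilter Γ) := Ultrafilter.semigroup
  let L : Set (Ultrafilter Γ) := {p | ∃ z ∈ C, Tendsto (fun g : Γ => g • y) p (𝓝 z)}
  -- An ultrafilter converging to the compact set `C` converges to a point of `C`.
  have conv : ∀ (p : Ultrafilter Γ) (w : X), Tendsto (fun g : Γ => g • w) p (𝓝ˢ C) →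
      ∃ z ∈ C, Tendsto (fun g : Γ => g • w) p (𝓝 z) := by
    intro p w h
    have hnd : ¬ Disjoint (𝓝ˢ C) (map (fun g : Γ => g • w) p) := by
      rw [disjoint_comm]
      intro hd
      exact (inferInstance : NeBot (map (fun g : Γ => g • w) p)).ne (hd.eq_bot_of_le h)
    rw [hC.disjoint_nhdsSet_left] at hnd
    push Not at hnd
    obtain ⟨z, hz, hzd⟩ := hnd
    refine ⟨z, hz, ?_⟩
    have : ClusterPt z (p.map (fun g : Γ => g • w) : Ultrafilter X) := by
      rw [ClusterPt, neBot_iff]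
      exact fun h => hzd (disjoint_iff.2 h)
    exact Ultrafilter.clusterPt_iff.1 this
  have hLeq : L = ⋂ O ∈ {O : Set X | IsOpen O ∧ C ⊆ O}, {p | {g : Γ | g • y ∈ O} ∈ p} := by
    ext p
    simp only [mem_iInter, mem_ofPred_eq, and_imp]
    constructor
    · rintro ⟨z, hz, h⟩ O hO hCO
      exact h (hO.mem_nhds (hCO hz))
    · intro h
      refine conv p y ?_
      rw [(hasBasis_nhdsSet C).tendsto_right_iff]
      exact fun O hO => h O hO.1 hO.2
  have hLclosed : IsClosed L := by
    rw [hLeq]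
    exact isClosed_biInter fun O _ => ultrafilter_isClosed_basic _
  have hLne : L.Nonempty := by
    rw [mem_closure_iff_ultrafilter] at hxy
    obtain ⟨u, hu, hux⟩ := hxy
    have hne : NeBot (comap (fun g : Γ => g • y) (u : Filter X)) :=
      comap_neBot_iff.2 fun t ht => by
        obtain ⟨_, ha, g, rfl⟩ := u.nonempty_of_mem (inter_mem ht hu)
        exact ⟨g, ha⟩
    refine ⟨Ultrafilter.of (comap (fun g : Γ => g • y) (u : Filter X)), x, hxC, ?_⟩
    exact (tendsto_comap.mono_left (Ultrafilter.of_le _)).mono_right hux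
  have hmul : ∀ (p q : Ultrafilter Γ) (w z z' : X), Tendsto (fun g : Γ => g • w) q (𝓝 z) →
      Tendsto (fun g : Γ => g • z) p (𝓝 z') →
      Tendsto (fun g : Γ => g • w) (p * q : Ultrafilter Γ) (𝓝 z') := by
    intro p q w z z' hq hp
    rw [tendsto_nhds]
    intro O hO hzO
    refine (Ultrafilter.eventually_mul p q (fun g => g • w ∈ O)).2 ?_
    filter_upwards [hp.eventually (hO.mem_nhds hzO)] with g hg
    have := ((continuous_const_smul g).tendsto z).comp hq
    filter_upwards [this.eventually (hO.mem_nhds hg)] with g' hg'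
    rw [mul_smul]
    exact hg'
  have hlim : ∀ (p : Ultrafilter Γ), ∀ z ∈ C, ∃ z' ∈ C, Tendsto (fun g : Γ => g • z) p (𝓝 z') := by
    intro p z hz
    refine conv p z ?_
    rw [(hasBasis_nhdsSet C).tendsto_right_iff]
    exact fun O hO => Eventually.of_forall fun g => hO.2 (hinv g z hz)
  obtain ⟨u, ⟨z, hz, huz⟩, huu⟩ := exists_idempotent_in_compact_subsemigroup
    (fun V : Ultrafilter Γ => Ultrafilter.continuous_mul_left V) L hLne hLclosed.isCompact (by
      rintro p - q ⟨z, hz, hq⟩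
      obtain ⟨z', hz', hp⟩ := hlim p z hz
      exact ⟨z', hz', hmul p q y z z' hq hp⟩)
  obtain ⟨z', hz', huz'⟩ := hlim u z hz
  have h2 := hmul u u y z z' huz huz'
  rw [huu] at h2
  obtain rfl := tendsto_nhds_unique huz h2
  refine ⟨z, hz, z, ?_⟩
  exact mem_closure_of_tendsto (huz.prodMk_nhds huz')
    (Eventually.of_forall fun g => mem_range_self g)

theorem smul_mem_closure_orbit [TopologicalSpace X] [ContinuousConstSMul Γ X] (g : Γ) {x y : X}
    (hy : y ∈ closure (MulAction.orbit Γ x)) : g • y ∈ closure (MulAction.orbit Γ x) :=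
  map_mem_closure (continuous_const_smul g) hy
    (by rintro _ ⟨k, rfl⟩; exact ⟨g * k, mul_smul g k x⟩)

/-- The orbit of a distal point can only accumulate at a point with compact orbit closure if this
orbit closure contains it. -/
theorem IsDistalPoint.mem_closure_orbit [TopologicalSpace X] [T2Space X]
    [ContinuousConstSMul Γ X] {x y : X} (hy : IsDistalPoint Γ y)
    (hx : IsCompact (closure (MulAction.orbit Γ x))) (hxy : x ∈ closure (MulAction.orbit Γ y)) :
    y ∈ closure (MulAction.orbit Γ x) := by
  obtain ⟨z, hz, hyz⟩ := exists_isProximalPair_of_isCompact hx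
    (fun g _ h => smul_mem_closure_orbit g h) (subset_closure (MulAction.mem_orbit_self x)) hxy
  rwa [← hy z hyz]

/-- Two points that are moved simultaneously to an equicontinuous point `z` coincide: the inverses
of the moving elements bring both of them uniformly close to the same translates of `z`. -/
theorem eq_of_mem_closure_of_equicontinuousAt [UniformSpace X] [T0Space X] {x y z : X}
    (hz : EquicontinuousAt (fun (g : Γ) (w : X) => g • w) z)
    (h : (z, z) ∈ closure (range fun g : Γ => (g • x, g • y))) : y = x := by
  refine eq_of_uniformity fun {E} hE => ?_
  obtain ⟨D, hD, hsymm, hDE⟩ := comp_symm_mem_uniformity_sets hE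
  have hW := hz D hD
  rw [mem_closure_iff_nhds] at h
  obtain ⟨_, ⟨h1, h2⟩, g, rfl⟩ := h _ (prod_mem_nhds hW hW)
  have h1 := h1 g⁻¹
  have h2 := h2 g⁻¹
  simp only [inv_smul_smul] at h1 h2
  exact hDE ⟨_, hsymm.symm _ _ h2, h1⟩

/-- Equicontinuity near a fixed point implies distality near that fixed point. -/
theorem exists_nhds_isDistalPoint [UniformSpace X] [T0Space X] {a : X}
    (ha : ∀ g : Γ, g • a = a) {N : Set X} (hN : N ∈ 𝓝 a)
    (h : ∀ x ∈ N, EquicontinuousAt (fun (g : Γ) (w : X) => g • w) x) :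
    ∃ N' ∈ 𝓝 a, ∀ x ∈ N', IsDistalPoint Γ x := by
  obtain ⟨F, hF, hFc, hFN⟩ := exists_mem_nhds_isClosed_subset hN
  obtain ⟨E, hE, hEF⟩ := UniformSpace.mem_nhds_iff.1 hF
  refine ⟨_, h a (mem_of_mem_nhds hN) E hE, ?_⟩
  rintro x hx y ⟨z, hz⟩
  refine eq_of_mem_closure_of_equicontinuousAt (h z (hFN ?_)) hz
  have hzx : z ∈ closure (range fun g : Γ => g • x) :=
    map_mem_closure continuous_fst hz (by rintro _ ⟨g, rfl⟩; exact ⟨g, rfl⟩)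
  refine closure_minimal ?_ hFc hzx
  rintro _ ⟨g, rfl⟩
  have hg : (g • a, g • x) ∈ E := hx g
  rw [ha] at hg
  exact hEF hg

theorem exists_mem_pow_of_closure_eq_top {T : Set Γ} (hinv : T⁻¹ = T)
    (hT : Subgroup.closure T = ⊤) (g : Γ) : ∃ n : ℕ, g ∈ T ^ n := by
  have hg : g ∈ Subgroup.closure T := hT ▸ Subgroup.mem_top g
  induction hg using Subgroup.closure_induction with
  | mem x hx => exact ⟨1, by simpa using hx⟩
  | one => exact ⟨0, by simp⟩
  | mul x y _ _ hx hy =>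
    obtain ⟨m, hm⟩ := hx
    obtain ⟨n, hn⟩ := hy
    exact ⟨m + n, by rw [pow_add]; exact mul_mem_mul hm hn⟩
  | inv x _ hx =>
    obtain ⟨m, hm⟩ := hx
    exact ⟨m, by rw [← hinv, inv_pow]; simpa using hm⟩

theorem uniformEquicontinuous_pow [UniformSpace X] {T : Set Γ}
    (hT : ∀ E ∈ 𝓤 X, ∀ᶠ p in 𝓤 X, ∀ t ∈ T, (t • p.1, t • p.2) ∈ E) (n : ℕ) :
    ∀ E ∈ 𝓤 X, ∀ᶠ p in 𝓤 X, ∀ t ∈ T ^ n, (t • p.1, t • p.2) ∈ E := by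
  induction n with
  | zero =>
    intro E hE
    filter_upwards [hE] with p hp t ht
    obtain rfl : t = 1 := by simpa using ht
    simpa only [one_smul] using hp
  | succ n ih =>
    intro E hE
    filter_upwards [hT _ (ih E hE)] with p hp t ht
    rw [pow_succ] at ht
    obtain ⟨a, ha, b, hb, rfl⟩ := mem_mul.1 ht
    simpa only [mul_smul] using hp b hb a ha

/-- A compact open set is a union of classes of an entourage. -/
theorem eventually_mem_iff_of_isCompact [UniformSpace X] {U : Set X} (hUc : IsCompact U)
    (hUo : IsOpen U) : ∀ᶠ p in 𝓤 X, (p.1 ∈ U ↔ p.2 ∈ U) := by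
  obtain ⟨E, hE, hEU⟩ := lebesgue_number_lemma (U := fun _ : Unit => U) hUc (fun _ => hUo)
    (subset_iUnion (fun _ : Unit => U) ())
  filter_upwards [hE, symm_le_uniformity hE] with p hp hp'
  constructor
  · intro h
    obtain ⟨-, hb⟩ := hEU _ h
    exact hb hp
  · intro h
    obtain ⟨-, hb⟩ := hEU _ h
    exact hb hp'

/-- The set of points whose orbits stay in a compact open set `U` is open, when the generating set
`T` acts uniformly equicontinuously and orbits of points of `N` are recurrent in the sense
of `hrec`.

Suppose the orbit of `x` stays in `U` but orbits starting arbitrarily close to `x` leave it. By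
equicontinuity the first exit, to a point `y` of the compact set `N \ U`, happens after a long
word, so that the translates of some point of the orbit of `y`, by all short words, lie in `U`.
Compactness of `N \ U` and then of `U` produces `y ∈ N \ U` and a point of the orbit closure of `y`
whose whole orbit lies in `U`. -/
theorem isOpen_setOf_orbit_subset [UniformSpace X] [T2Space X] [ContinuousConstSMul Γ X]
    {T : Set Γ} (h1 : 1 ∈ T) (hinv : T⁻¹ = T) (htop : Subgroup.closure T = ⊤)
    (hT : ∀ E ∈ 𝓤 X, ∀ᶠ p in 𝓤 X, ∀ t ∈ T, (t • p.1, t • p.2) ∈ E)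
    {U N : Set X} (hUc : IsCompact U) (hUo : IsOpen U) (hNc : IsCompact N)
    (hTU : ∀ t ∈ T, ∀ x ∈ U, t • x ∈ N)
    (hrec : ∀ x ∈ U, ∀ y ∈ N, IsCompact (closure (MulAction.orbit Γ x)) →
      x ∈ closure (MulAction.orbit Γ y) → y ∈ closure (MulAction.orbit Γ x)) :
    IsOpen {x : X | ∀ g : Γ, g • x ∈ U} := by
  -- Whether the translates of a point by words of bounded length lie in `U` is unchanged by moving
  -- the point within a suitable entourage.
  have hsat : ∀ n : ℕ, ∀ᶠ p in 𝓤 X, ∀ t ∈ T ^ n, (t • p.1 ∈ U ↔ t • p.2 ∈ U) := by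
    intro n
    filter_upwards [uniformEquicontinuous_pow hT n _ (eventually_mem_iff_of_isCompact hUc hUo)]
      with p hp t ht using hp t ht
  have hmono : ∀ {m n : ℕ}, m ≤ n → T ^ m ⊆ T ^ n := fun h => Set.pow_subset_pow_right h1 h
  have hpinv : ∀ {n : ℕ} {g : Γ}, g ∈ T ^ n → g⁻¹ ∈ T ^ n := by
    intro n g hg
    rw [← hinv, inv_pow]
    simpa using hg
  rw [isOpen_iff_mem_nhds]
  intro x hx
  by_contra hnot
  -- `P n`: some translate of `y` by a word of length at most `n + 1` has its `n`-ball inside `U`.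
  let P : ℕ → Set X := fun n => {y | ∃ w ∈ T ^ (n + 1), ∀ v ∈ T ^ n, (v * w) • y ∈ U}
  have hPne : ∀ n, ((N \ U) ∩ P n).Nonempty := by
    intro n
    have hnear : ∀ᶠ x' in 𝓝 x, ∀ t ∈ T ^ (n + 1), t • x' ∈ U := by
      filter_upwards [UniformSpace.ball_mem_nhds x (hsat (n + 1))] with x' hx' t ht
      exact (hx' t ht).1 (hx t)
    obtain ⟨x', hx', hx'n⟩ : ∃ x', x' ∉ {x : X | ∀ g : Γ, g • x ∈ U} ∧
        ∀ t ∈ T ^ (n + 1), t • x' ∈ U := by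
      by_contra! hc
      refine hnot ?_
      filter_upwards [hnear] with x' h
      by_contra hx'
      obtain ⟨t, ht, htU⟩ := hc x' hx'
      exact htU (h t ht)
    have hexit : ∃ m, ∃ g ∈ T ^ m, g • x' ∉ U := by
      simp only [mem_ofPred_eq, not_forall] at hx'
      obtain ⟨g, hg⟩ := hx'
      obtain ⟨m, hm⟩ := exists_mem_pow_of_closure_eq_top hinv htop g
      exact ⟨m, g, hm, hg⟩
    classical
    -- `g` is a shortest word moving `x'` out of `U`; the exit point is `g • x'`.
    obtain ⟨g, hg, hgU⟩ := Nat.find_spec hexit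
    have hmin : ∀ k < Nat.find hexit, ∀ v ∈ T ^ k, v • x' ∈ U := by
      intro k hk v hv
      by_contra hc
      exact Nat.find_min hexit hk ⟨v, hv, hc⟩
    have hlt : n + 1 < Nat.find hexit := by
      by_contra hc
      exact hgU (hx'n g (hmono (not_lt.1 hc) hg))
    generalize Nat.find hexit = m at *
    refine ⟨g • x', ⟨?_, hgU⟩, ?_⟩
    · obtain ⟨k, rfl⟩ : ∃ k, m = 1 + k := ⟨m - 1, by omega⟩
      rw [pow_add, pow_one] at hg
      obtain ⟨t, ht, g', hg', rfl⟩ := mem_mul.1 hg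
      rw [mul_smul]
      exact hTU t ht _ (hmin k (by omega) g' hg')
    · obtain ⟨k, rfl⟩ : ∃ k, m = (n + 1) + k := ⟨m - (n + 1), by omega⟩
      rw [pow_add] at hg
      obtain ⟨a, ha, b, hb, rfl⟩ := mem_mul.1 hg
      refine ⟨a⁻¹, hpinv ha, fun v hv => ?_⟩
      rw [smul_smul, show v * a⁻¹ * (a * b) = v * b by group]
      exact hmin (n + k) (by omega) _ (by rw [pow_add]; exact mul_mem_mul hv hb)
  have hPanti : ∀ n, P (n + 1) ⊆ P n := by
    rintro n y ⟨w, hw, h⟩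
    rw [add_comm, pow_add, pow_one] at hw
    obtain ⟨t, ht, w', hw', rfl⟩ := mem_mul.1 hw
    refine ⟨w', hw', fun v hv => ?_⟩
    have := h (v * t⁻¹) (by
      rw [pow_succ]
      exact mul_mem_mul hv (hinv ▸ inv_mem_inv.2 ht))
    rwa [show v * t⁻¹ * (t * w') = v * w' by group] at this
  have hPclosed : ∀ n, IsClosed (P n) := by
    intro n
    rw [isClosed_iff_nhds]
    intro y hy
    obtain ⟨y', hyy', w, hw, h⟩ := hy _ (UniformSpace.ball_mem_nhds y (hsat (n + (n + 1))))
    exact ⟨w, hw, fun v hv => (hyy' _ (by rw [pow_add]; exact mul_mem_mul hv hw)).2 (h v hv)⟩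
  have hNU : IsCompact (N \ U) := hNc.diff hUo
  obtain ⟨y, hy⟩ := IsCompact.nonempty_iInter_of_sequence_nonempty_isCompact_isClosed
    (fun n => (N \ U) ∩ P n) (fun n => inter_subset_inter_right _ (hPanti n)) hPne
    (hNU.inter_right (hPclosed 0)) (fun n => hNU.isClosed.inter (hPclosed n))
  rw [mem_iInter] at hy
  let Z : ℕ → Set X := fun n => closure (MulAction.orbit Γ y) ∩ {z | ∀ v ∈ T ^ n, v • z ∈ U}
  have hZclosed : ∀ n, IsClosed (Z n) := by
    intro n
    refine isClosed_closure.inter ?_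
    simp only [ofPred_forall]
    exact isClosed_biInter fun v _ => hUc.isClosed.preimage (continuous_const_smul v)
  have hZU : Z 0 ⊆ U := fun z hz => by simpa using hz.2 1 (by simp)
  obtain ⟨z, hz⟩ := IsCompact.nonempty_iInter_of_sequence_nonempty_isCompact_isClosed Z
    (fun n z hz => ⟨hz.1, fun v hv => hz.2 v (hmono n.le_succ hv)⟩)
    (fun n => by
      obtain ⟨w, -, h⟩ := (hy n).2
      exact ⟨w • y, subset_closure (MulAction.mem_orbit y w), fun v hv => by
        rw [smul_smul]; exact h v hv⟩)
    (hUc.of_isClosed_subset (hZclosed 0) hZU) hZclosed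
  rw [mem_iInter] at hz
  have hzorb : closure (MulAction.orbit Γ z) ⊆ U := by
    refine closure_minimal ?_ hUc.isClosed
    rintro _ ⟨g, rfl⟩
    obtain ⟨n, hn⟩ := exists_mem_pow_of_closure_eq_top hinv htop g
    exact (hz n).2 g hn
  exact (hy 0).1.2 (hzorb (hrec z (hzorb (subset_closure (MulAction.mem_orbit_self z))) y (hy 0).1.1
    (hUc.of_isClosed_subset isClosed_closure hzorb) (hz 0).1))

end Actions

/-! ### Coset spaces -/

section CosetSpace

variable {G : Type*} [Group G] [TopologicalSpace G]

theorem isInvariant_iff {H : Subgroup (G ≃ₜ* G)} {X : Set G} :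
    IsInvariant H X ↔ ∀ h ∈ H, ∀ x ∈ X, h x ∈ X := by
  refine ⟨fun hX h hh x hx => hX h hh ▸ mem_image_of_mem _ hx, fun hX h hh => ?_⟩
  refine Subset.antisymm (by rintro _ ⟨x, hx, rfl⟩; exact hX h hh x hx) fun x hx => ?_
  exact ⟨h⁻¹ x, hX _ (H.inv_mem hh) x hx, h.apply_symm_apply x⟩

theorem IsInvariant.map_mem {H : Subgroup (G ≃ₜ* G)} {X : Set G} (hX : IsInvariant H X) (h : H)
    {x : G} (hx : x ∈ X) : (h : G ≃ₜ* G) x ∈ X :=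
  isInvariant_iff.1 hX h h.2 x hx

/-- The automorphisms in `H` are compatible with the left translations of `G/K`. -/
theorem cosetAction_smul_smul {H : Subgroup (G ≃ₜ* G)} {K : Subgroup G}
    (hK : IsInvariant H (K : Set G)) (h : H) (g : G) (x : G ⧸ K) :
    letI := cosetAction hK
    h • (g • x) = (h : G ≃ₜ* G) g • (h • x) := by
  induction x using QuotientGroup.induction_on with | H x => ?_
  exact congrArg _ (map_mul (h : G ≃ₜ* G) g x)

theorem continuousConstSMul_coset {H : Subgroup (G ≃ₜ* G)} {K : Subgroup G}
    (hK : IsInvariant H (K : Set G)) :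
    letI := cosetAction hK
    ContinuousConstSMul H (G ⧸ K) := by
  let _ := cosetAction hK
  refine ⟨fun h => (QuotientGroup.isQuotientMap_mk K).continuous_iff.2 ?_⟩
  exact QuotientGroup.continuous_mk.comp (map_continuous (h : G ≃ₜ* G))

theorem isInvariant_discreteResidual (H : Subgroup (G ≃ₜ* G)) :
    IsInvariant H (discreteResidual H : Set G) := by
  refine isInvariant_iff.2 fun h hh x hx => ?_
  rw [SetLike.mem_coe, discreteResidual, Subgroup.mem_sInf] at hx ⊢
  exact fun V hV => isInvariant_iff.1 hV.2 h hh x (hx V hV)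

variable [IsTopologicalGroup G]

theorem isClosed_discreteResidual (H : Subgroup (G ≃ₜ* G)) :
    IsClosed (discreteResidual H : Set G) := by
  rw [discreteResidual, Subgroup.coe_sInf]
  exact isClosed_biInter fun V hV => V.isClosed_of_isOpen hV.1

theorem hasBasis_cosetRightUniformity (K : Subgroup G) :
    (@uniformity _ (cosetRightUniformSpace K)).HasBasis (· ∈ 𝓝 (1 : G)) (cosetEntourage K) :=
  (𝓝 (1 : G)).basis_sets.lift' (cosetEntourage_mono K)

theorem t2Space_coset {K : Subgroup G} (hK : IsClosed (K : Set G)) : T2Space (G ⧸ K) := by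
  let _ := cosetRightUniformSpace K
  have : T1Space (G ⧸ K) := by
    refine ⟨fun p => ?_⟩
    induction p using QuotientGroup.induction_on with | H x => ?_
    rw [← (QuotientGroup.isQuotientMap_mk K).isClosed_preimage]
    convert hK.preimage (continuous_const_mul x⁻¹) using 1
    ext y
    rw [mem_preimage, mem_singleton_iff, eq_comm, QuotientGroup.eq]
    rfl
  infer_instance

/-- Compact open neighbourhoods of the trivial coset exist below any neighbourhood. -/
theorem exists_isCompact_isOpen_subset_coset [T2Space G] [LocallyCompactSpace G]
    [TotallyDisconnectedSpace G] (K : Subgroup G) {N : Set (G ⧸ K)}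
    (hN : N ∈ 𝓝 ((1 : G) : G ⧸ K)) :
    ∃ U ⊆ N, IsCompact U ∧ IsOpen U ∧ ((1 : G) : G ⧸ K) ∈ U := by
  have hN' : ((↑) : G → G ⧸ K) ⁻¹' N ∈ 𝓝 (1 : G) := QuotientGroup.continuous_mk.continuousAt hN
  obtain ⟨C, hC, hCN, hCc⟩ := local_compact_nhds hN'
  obtain ⟨A, hA, h1A, hAC⟩ :=
    (loc_compact_Haus_tot_disc_of_zero_dim (H := G)).mem_nhds_iff.1 hC
  refine ⟨(↑) '' A, image_subset_iff.2 (hAC.trans hCN), ?_, ?_, 1, h1A, rfl⟩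
  · exact (hCc.of_isClosed_subset hA.1 hAC).image QuotientGroup.continuous_mk
  · exact QuotientGroup.isOpenMap_coe _ hA.2

theorem exists_equicontinuous_generating_set {H : Subgroup (G ≃ₜ* G)}
    (hH : IsEquicontinuouslyGenerated H) :
    ∃ T : Set H, 1 ∈ T ∧ T⁻¹ = T ∧ Subgroup.closure T = ⊤ ∧
      ∀ U ∈ 𝓝 (1 : G), ∀ᶠ w in 𝓝 (1 : G), ∀ t ∈ T, (t : G ≃ₜ* G) w ∈ U := by
  obtain ⟨S, hS, rfl, hSeq⟩ := hH
  refine ⟨insert 1 ((↑) ⁻¹' S), mem_insert _ _, ?_, ?_, fun U hU => ?_⟩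
  · ext t
    have : ((t⁻¹ : Subgroup.closure S) : G ≃ₜ* G) ∈ S ↔ (t : G ≃ₜ* G) ∈ S := by
      exact (Set.ext_iff.1 hS (t : G ≃ₜ* G) :)
    simp only [Set.mem_inv, mem_insert_iff, inv_eq_one, mem_preimage, this]
  · rw [eq_top_iff, ← Subgroup.closure_closure_coe_preimage]
    exact Subgroup.closure_mono (subset_insert _ _)
  · let _ : UniformSpace G := IsTopologicalGroup.rightUniformSpace G
    obtain ⟨E, hE, hEU⟩ := UniformSpace.mem_nhds_iff.1 hU
    filter_upwards [hSeq 1 E hE, hU] with w hw hwU t ht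
    rcases ht with rfl | ht
    · exact hwU
    · have := hw ⟨t, ht⟩
      simp only [map_one] at this
      exact hEU this

/-- A set of automorphisms that is equicontinuous at the identity acts uniformly equicontinuously
on `G/K`, by the translation invariance of the right uniformity. -/
theorem uniformEquicontinuous_coset {H : Subgroup (G ≃ₜ* G)} {K : Subgroup G}
    (hK : IsInvariant H (K : Set G)) {T : Set H}
    (hT : ∀ U ∈ 𝓝 (1 : G), ∀ᶠ w in 𝓝 (1 : G), ∀ t ∈ T, (t : G ≃ₜ* G) w ∈ U) :
    letI := cosetAction hK
    letI := cosetRightUniformSpace K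
    ∀ E ∈ uniformity (G ⧸ K), ∀ᶠ p in uniformity (G ⧸ K), ∀ t ∈ T, (t • p.1, t • p.2) ∈ E := by
  let _ := cosetAction hK
  intro E hE
  obtain ⟨U, hU, hUE⟩ := (hasBasis_cosetRightUniformity K).mem_iff.1 hE
  filter_upwards [(hasBasis_cosetRightUniformity K).mem_of_mem (hT U hU)]
  rintro ⟨p, q⟩ hpq t ht
  induction p using QuotientGroup.induction_on with | H x => ?_
  induction q using QuotientGroup.induction_on with | H y => ?_
  obtain ⟨w, hw, h⟩ := mk_mem_cosetEntourage.1 hpq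
  refine hUE (mk_mem_cosetEntourage.2 ⟨_, hw t ht, ?_⟩)
  exact (cosetAction_smul_smul hK t w y).symm.trans (congrArg (fun p : G ⧸ K => t • p) h)

/-- The recurrence condition on `G/K`: near the trivial coset, whenever the orbit of `y` accumulates
at a point `x` with compact orbit closure, this orbit closure contains `y`. -/
def IsNRecurrent {H : Subgroup (G ≃ₜ* G)} {K : Subgroup G} (hK : IsInvariant H (K : Set G)) :
    Prop :=
  ∃ N ∈ 𝓝 ((1 : G) : G ⧸ K), ∀ x ∈ N, ∀ y ∈ N, IsCompact (closure (cosetOrbit hK x)) →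
    x ∈ closure (cosetOrbit hK y) → y ∈ closure (cosetOrbit hK x)

/-- Every neighbourhood of the trivial coset in `G/K` contains `VK/K` for some open `H`-invariant
subgroup `V`. -/
def HasSmallInvariantSubgroups (H : Subgroup (G ≃ₜ* G)) (K : Subgroup G) : Prop :=
  ∀ N ∈ 𝓝 ((1 : G) : G ⧸ K), ∃ V : Subgroup G, IsOpen (V : Set G) ∧ IsInvariant H (V : Set G) ∧
    ((↑) : G → G ⧸ K) '' (V : Set G) ⊆ N

theorem hasBasis_iff_hasSmallInvariantSubgroups {H : Subgroup (G ≃ₜ* G)} {K : Subgroup G} :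
    (𝓝 ((1 : G) : G ⧸ K)).HasBasis
      (fun V : Subgroup G => IsOpen (V : Set G) ∧ IsInvariant H (V : Set G))
      (fun V => ((↑) : G → G ⧸ K) '' (V : Set G)) ↔ HasSmallInvariantSubgroups H K := by
  simp only [hasBasis_iff, HasSmallInvariantSubgroups, and_assoc]
  refine ⟨fun h N hN => (h N).1 hN, fun h N => ⟨h N, ?_⟩⟩
  rintro ⟨V, hV, -, hVN⟩
  exact mem_of_superset ((QuotientGroup.isOpenMap_coe _ hV).mem_nhds ⟨1, V.one_mem, rfl⟩) hVN

theorem HasSmallInvariantSubgroups.discreteResidual_le {H : Subgroup (G ≃ₜ* G)} {K : Subgroup G}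
    (hKc : IsClosed (K : Set G)) (h : HasSmallInvariantSubgroups H K) :
    discreteResidual H ≤ K := by
  intro g hg
  by_contra hgK
  have := t2Space_coset hKc
  have hne : ((1 : G) : G ⧸ K) ≠ (g : G ⧸ K) := by
    rw [Ne, QuotientGroup.eq]
    simpa using hgK
  obtain ⟨V, hVo, hVi, hV⟩ := h {(g : G ⧸ K)}ᶜ (isOpen_compl_singleton.mem_nhds hne)
  rw [discreteResidual, Subgroup.mem_sInf] at hg
  exact hV ⟨g, hg V ⟨hVo, hVi⟩, rfl⟩ rfl

theorem ActsNEquicontinuously.actsNDistally {H : Subgroup (G ≃ₜ* G)} {K : Subgroup G}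
    {hK : IsInvariant H (K : Set G)} (hKc : IsClosed (K : Set G))
    (h : ActsNEquicontinuously hK) : ActsNDistally hK := by
  let _ := cosetAction hK
  let _ := cosetRightUniformSpace K
  have := t2Space_coset hKc
  obtain ⟨N, hN, h⟩ := h
  exact exists_nhds_isDistalPoint
    (fun g => congrArg ((↑) : G → G ⧸ K) (map_one (g : G ≃ₜ* G))) hN h

theorem ActsNDistally.isNRecurrent {H : Subgroup (G ≃ₜ* G)} {K : Subgroup G}
    {hK : IsInvariant H (K : Set G)} (hKc : IsClosed (K : Set G))
    (h : ActsNDistally hK) : IsNRecurrent hK := by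
  let _ := cosetAction hK
  have := t2Space_coset hKc
  have := continuousConstSMul_coset hK
  obtain ⟨N, hN, h⟩ := h
  exact ⟨N, hN, fun x _ y hy hx hxy => (h y hy).mem_closure_orbit hx hxy⟩

/-- For a compact open `H`-invariant neighbourhood `X` of the trivial coset, the stabiliser of `X`
in `G` is an open `H`-invariant subgroup. -/
theorem exists_isInvariant_subgroup_of_isCompact {H : Subgroup (G ≃ₜ* G)} {K : Subgroup G}
    (hK : IsInvariant H (K : Set G)) {X : Set (G ⧸ K)} (hXc : IsCompact X) (hXo : IsOpen X)
    (h1 : ((1 : G) : G ⧸ K) ∈ X)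
    (hX : letI := cosetAction hK; ∀ (h : H) (x : G ⧸ K), h • x ∈ X ↔ x ∈ X) :
    ∃ V : Subgroup G, IsOpen (V : Set G) ∧ IsInvariant H (V : Set G) ∧
      ((↑) : G → G ⧸ K) '' (V : Set G) ⊆ X := by
  let _ := cosetAction hK
  refine ⟨MulAction.stabilizer G X, ?_, isInvariant_iff.2 fun h hh g hg => ?_, ?_⟩
  · let _ := cosetRightUniformSpace K
    obtain ⟨W, hW, hWX⟩ := (hasBasis_cosetRightUniformity K).mem_iff.1
      (eventually_mem_iff_of_isCompact hXc hXo)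
    refine Subgroup.isOpen_of_mem_nhds _ (g := 1) (mem_of_superset hW fun w hw => ?_)
    refine MulAction.mem_stabilizer_set.2 fun b => ?_
    induction b using QuotientGroup.induction_on with | H b => ?_
    exact hWX (show (((w * b : G) : G ⧸ K), (b : G ⧸ K)) ∈ _ from
      mk_mem_cosetEntourage.2 ⟨w, hw, rfl⟩)
  · refine MulAction.mem_stabilizer_set.2 fun b => ?_
    have key := cosetAction_smul_smul hK ⟨h, hh⟩ g ((⟨h, hh⟩ : H)⁻¹ • b)
    rw [smul_inv_smul] at key
    rw [← key, hX, MulAction.mem_stabilizer_set.1 hg, hX]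
  · rintro _ ⟨g, hg, rfl⟩
    have := (MulAction.mem_stabilizer_set.1 hg ((1 : G) : G ⧸ K)).2 h1
    simpa using this

theorem IsNRecurrent.hasSmallInvariantSubgroups [T2Space G] [LocallyCompactSpace G]
    [TotallyDisconnectedSpace G] {H : Subgroup (G ≃ₜ* G)} (hH : IsEquicontinuouslyGenerated H)
    {K : Subgroup G} {hK : IsInvariant H (K : Set G)} (hKc : IsClosed (K : Set G))
    (h : IsNRecurrent hK) : HasSmallInvariantSubgroups H K := by
  let _ := cosetAction hK
  have := t2Space_coset hKc
  have := continuousConstSMul_coset hK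
  obtain ⟨N₀, hN₀, h⟩ := h
  intro N₁ hN₁
  obtain ⟨T, h1T, hTinv, htop, hTeq⟩ := exists_equicontinuous_generating_set hH
  obtain ⟨N, hNN, hNc, hNo, h1N⟩ := exists_isCompact_isOpen_subset_coset K (inter_mem hN₀ hN₁)
  have hfix : ∀ g : H, g • ((1 : G) : G ⧸ K) = ((1 : G) : G ⧸ K) :=
    fun g => congrArg ((↑) : G → G ⧸ K) (map_one (g : G ≃ₜ* G))
  let _ := cosetRightUniformSpace K
  have hT := uniformEquicontinuous_coset hK hTeq
  have hnear : {x : G ⧸ K | ∀ t ∈ T, t • x ∈ N} ∈ 𝓝 ((1 : G) : G ⧸ K) := by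
    obtain ⟨E, hE, hEN⟩ := UniformSpace.mem_nhds_iff.1 (hNo.mem_nhds h1N)
    filter_upwards [UniformSpace.ball_mem_nhds _ (hT E hE)] with x hx t ht
    have ht' : (t • ((1 : G) : G ⧸ K), t • x) ∈ E := hx t ht
    rw [hfix] at ht'
    exact hEN ht'
  obtain ⟨U, hUN, hUc, hUo, h1U⟩ := exists_isCompact_isOpen_subset_coset K hnear
  have hUN' : U ⊆ N := fun x hx => by simpa using hUN hx 1 h1T
  have hXo := isOpen_setOf_orbit_subset h1T hTinv htop hT hUc hUo hNc
    (fun t ht x hx => hUN hx t ht)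
    (fun x hx y hy => h x (hNN (hUN' hx)).1 y (hNN hy).1)
  have hXU : {x : G ⧸ K | ∀ g : H, g • x ∈ U} ⊆ U := fun x hx => by simpa using hx 1
  have hXc : IsCompact {x : G ⧸ K | ∀ g : H, g • x ∈ U} := by
    refine hUc.of_isClosed_subset ?_ hXU
    simp only [ofPred_forall]
    exact isClosed_iInter fun g => hUc.isClosed.preimage (continuous_const_smul g)
  obtain ⟨V, hVo, hVi, hV⟩ := exists_isInvariant_subgroup_of_isCompact hK hXc hXo
    (fun g => by rw [hfix]; exact h1U) (fun g x => ⟨fun hx k => by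
      simpa [smul_smul] using hx (k * g⁻¹), fun hx k => by simpa [smul_smul] using hx (k * g)⟩)
  exact ⟨V, hVo, hVi, hV.trans (hXU.trans (hUN'.trans (hNN.trans inter_subset_right)))⟩

end CosetSpace

/-! ### The discrete residual -/

section Residual

variable {G : Type*} [Group G] [TopologicalSpace G] [IsTopologicalGroup G]

/-- `G/Res_G(H)` embeds `H`-equivariantly into the product of the discrete spaces `G/V`, for `V`
an open `H`-invariant subgroup, so that a compact orbit closure is determined by its images in
these spaces, where accumulation of orbits is equality. -/
theorem isNRecurrent_discreteResidual (H : Subgroup (G ≃ₜ* G)) :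
    IsNRecurrent (isInvariant_discreteResidual H) := by
  set R := discreteResidual H with hR
  have hRi := isInvariant_discreteResidual H
  let _ := cosetAction hRi
  have := continuousConstSMul_coset hRi
  refine ⟨univ, univ_mem, fun x _ y _ hx hxy => ?_⟩
  change IsCompact (closure (MulAction.orbit H x)) at hx
  change x ∈ closure (MulAction.orbit H y) at hxy
  change y ∈ closure (MulAction.orbit H x)
  let ι := {V : Subgroup G // IsOpen (V : Set G) ∧ IsInvariant H (V : Set G)}
  have hle : ∀ V : ι, R ≤ V.1 := fun V => sInf_le V.2
  let π : ∀ V : ι, G ⧸ R → G ⧸ V.1 := fun V => Subgroup.quotientMapOfLE (hle V)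
  have hdisc : ∀ V : ι, DiscreteTopology (G ⧸ V.1) :=
    fun V => QuotientGroup.discreteTopology V.2.1
  have hπ : ∀ V : ι, Continuous (π V) := fun V =>
    (QuotientGroup.isQuotientMap_mk R).continuous_iff.2 QuotientGroup.continuous_mk
  induction x using QuotientGroup.induction_on with | H a => ?_
  induction y using QuotientGroup.induction_on with | H b => ?_
  let F : ι → Set (G ⧸ R) := fun V =>
    closure (MulAction.orbit H (a : G ⧸ R)) ∩ π V ⁻¹' {(b : G ⧸ V.1)}
  have hFc : ∀ V, IsClosed (F V) := fun V =>
    isClosed_closure.inter ((isClosed_discrete _).preimage (hπ V))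
  have hFne : ∀ V, (F V).Nonempty := by
    intro V
    obtain ⟨_, hp, ⟨h, rfl⟩⟩ := mem_closure_iff.1 hxy (π V ⁻¹' {(a : G ⧸ V.1)})
      ((isOpen_discrete _).preimage (hπ V)) rfl
    have hp' : (((h : G ≃ₜ* G) b : G) : G ⧸ V.1) = (a : G ⧸ V.1) := hp
    refine ⟨h⁻¹ • (a : G ⧸ R), subset_closure (MulAction.mem_orbit _ _), ?_⟩
    change ((((h⁻¹ : H) : G ≃ₜ* G) a : G) : G ⧸ V.1) = (b : G ⧸ V.1)
    rw [QuotientGroup.eq] at hp'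
    have := V.2.2.map_mem h⁻¹ hp'
    rw [map_mul, map_inv, show ((h⁻¹ : H) : G ≃ₜ* G) ((h : G ≃ₜ* G) b) = b from
      (h : G ≃ₜ* G).symm_apply_apply b] at this
    rw [eq_comm, QuotientGroup.eq]
    exact this
  have : Nonempty ι := ⟨⟨⊤, isOpen_univ, isInvariant_iff.2 fun _ _ _ _ => trivial⟩⟩
  obtain ⟨p, hp⟩ := IsCompact.nonempty_iInter_of_directed_nonempty_isCompact_isClosed F (by
      intro V W
      refine ⟨⟨V.1 ⊓ W.1, V.2.1.inter W.2.1, isInvariant_iff.2 fun h hh x hx =>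
        ⟨isInvariant_iff.1 V.2.2 h hh x hx.1, isInvariant_iff.1 W.2.2 h hh x hx.2⟩⟩, ?_, ?_⟩
      all_goals
        rintro p ⟨hp1, hp2⟩
        refine ⟨hp1, ?_⟩
        induction p using QuotientGroup.induction_on with | H c => ?_
        have hp2' := QuotientGroup.eq.1 (show (c : G ⧸ V.1 ⊓ W.1) = b from hp2)
      · exact QuotientGroup.eq.2 hp2'.1
      · exact QuotientGroup.eq.2 hp2'.2)
    hFne (fun V => hx.of_isClosed_subset (hFc V) inter_subset_left) hFc
  rw [mem_iInter] at hp
  induction p using QuotientGroup.induction_on with | H c => ?_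
  have hcb : (c : G ⧸ R) = b := by
    rw [QuotientGroup.eq, hR, discreteResidual, Subgroup.mem_sInf]
    exact fun V hV => QuotientGroup.eq.1 (hp ⟨V, hV⟩).2
  exact hcb ▸ (hp Classical.ofNonempty).1

/-- If the `H`-orbit of `x` lies in `U * Res_G(H)` with `U` compact, then `x` normalises
`Res_G(H)`: for each open `H`-invariant subgroup `V`, only the conjugates of `V` by the elements
of `U` matter in the intersection of all `H`-translates of `x V x⁻¹`, which is therefore an open
`H`-invariant subgroup. -/
theorem conj_mem_discreteResidual {H : Subgroup (G ≃ₜ* G)} {U : Set G} (hU : IsCompact U) {x : G}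
    (hx : ∀ h ∈ H, h x ∈ U * (discreteResidual H : Set G)) {r : G}
    (hr : r ∈ discreteResidual H) : x⁻¹ * r * x ∈ discreteResidual H := by
  rw [discreteResidual, Subgroup.mem_sInf]
  rintro V ⟨hVo, hVi⟩
  have hRV : discreteResidual H ≤ V := sInf_le ⟨hVo, hVi⟩
  let W : Subgroup G := ⨅ h : H, V.comap (MulAut.conj ((h : G ≃ₜ* G) x)⁻¹).toMonoidHom
  have hW : ∀ g, g ∈ W ↔ ∀ h : H, ((h : G ≃ₜ* G) x)⁻¹ * g * (h : G ≃ₜ* G) x ∈ V := by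
    intro g
    simp [W, Subgroup.mem_iInf]
  have hWo : IsOpen (W : Set G) := by
    have hnear : ∀ᶠ g in 𝓝 (1 : G), ∀ u ∈ U, u⁻¹ * g * u ∈ V := by
      refine hU.eventually_forall_of_forall_eventually fun u _ => ?_
      have hc : Continuous fun p : G × G => p.2⁻¹ * p.1 * p.2 := by fun_prop
      exact hc.continuousAt.eventually (hVo.mem_nhds (by simp))
    refine Subgroup.isOpen_of_mem_nhds _ (g := 1) ?_
    filter_upwards [hnear] with g hg
    refine (hW g).2 fun h => ?_
    obtain ⟨u, hu, s, hs, hus⟩ := Set.mem_mul.1 (hx h h.2)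
    rw [← hus, show (u * s)⁻¹ * g * (u * s) = s⁻¹ * (u⁻¹ * g * u) * s by group]
    exact V.mul_mem (V.mul_mem (V.inv_mem (hRV hs)) (hg u hu)) (hRV hs)
  have hWi : IsInvariant H (W : Set G) := by
    refine isInvariant_iff.2 fun k hk g hg => (hW _).2 fun h => ?_
    have := hVi.map_mem ⟨k, hk⟩ ((hW g).1 hg (⟨k, hk⟩⁻¹ * h))
    rw [map_mul, map_mul, map_inv] at this
    rwa [show k (((⟨k, hk⟩⁻¹ * h : H) : G ≃ₜ* G) x) = (h : G ≃ₜ* G) x from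
      k.apply_symm_apply _] at this
  have hrW : r ∈ W := by
    rw [discreteResidual, Subgroup.mem_sInf] at hr
    exact hr W ⟨hWo, hWi⟩
  exact (hW r).1 hrW 1

/-- When the subsets `V Res_G(H) / Res_G(H)` form a base of neighbourhoods of the trivial
coset, some open `H`-invariant subgroup `V₀` normalises `R = Res_G(H)`. For `x ∈ V₀` and `v` in an
open `H`-invariant subgroup `V ⊆ W R`, the coset `h(vx)K = h(v)h(x)K` lies in
`W R h(x) K = W h(x) K`, which gives equicontinuity at `xK`. -/
theorem actsNEquicontinuously_of_discreteResidual_le [LocallyCompactSpace G]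
    {H : Subgroup (G ≃ₜ* G)} {K : Subgroup G} (hK : IsInvariant H (K : Set G))
    (hR : HasSmallInvariantSubgroups H (discreteResidual H)) (hle : discreteResidual H ≤ K) :
    ActsNEquicontinuously hK := by
  let _ := cosetAction hK
  let _ := cosetRightUniformSpace K
  have hsmall : ∀ W ∈ 𝓝 (1 : G), ∃ V : Subgroup G, IsOpen (V : Set G) ∧
      IsInvariant H (V : Set G) ∧ (V : Set G) ⊆ W * (discreteResidual H : Set G) := by
    intro W hW
    obtain ⟨V, hVo, hVi, hV⟩ := hR ((↑) '' W) (QuotientGroup.isOpenMap_coe.image_mem_nhds hW)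
    refine ⟨V, hVo, hVi, fun v hv => ?_⟩
    obtain ⟨w, hw, hwv⟩ := hV ⟨v, hv, rfl⟩
    exact Set.mem_mul.2 ⟨w, hw, w⁻¹ * v, QuotientGroup.eq.1 hwv, by group⟩
  obtain ⟨U, hU, hU1⟩ := exists_compact_mem_nhds (1 : G)
  obtain ⟨V₀, hV₀o, hV₀i, hV₀⟩ := hsmall U hU1
  refine ⟨(↑) '' (V₀ : Set G),
    (QuotientGroup.isOpenMap_coe _ hV₀o).mem_nhds ⟨1, V₀.one_mem, rfl⟩, ?_⟩
  rintro _ ⟨x, hx, rfl⟩ E hE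
  obtain ⟨W, hW, hWE⟩ := (hasBasis_cosetRightUniformity K).mem_iff.1 (symm_le_uniformity hE)
  obtain ⟨V, hVo, hVi, hV⟩ := hsmall W hW
  have hVx : (fun v : G => ((v * x : G) : G ⧸ K)) '' (V : Set G) ∈ 𝓝 (x : G ⧸ K) :=
    ((QuotientGroup.isOpenMap_coe.comp (isOpenMap_mul_right x)) _ hVo).mem_nhds
      ⟨1, V.one_mem, by simp⟩
  filter_upwards [hVx]
  rintro _ ⟨v, hv, rfl⟩ h
  obtain ⟨w, hw, r, hr, hwr⟩ := Set.mem_mul.1 (hV (hVi.map_mem h hv))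
  have hr' := conj_mem_discreteResidual hU (x := (h : G ≃ₜ* G) x)
    (fun k hk => hV₀ (hV₀i.map_mem ⟨k, hk⟩ (hV₀i.map_mem h hx))) hr
  refine hWE (show ((((h : G ≃ₜ* G) (v * x) : G) : G ⧸ K), (((h : G ≃ₜ* G) x : G) : G ⧸ K)) ∈
    cosetEntourage K W from mk_mem_cosetEntourage.2 ⟨w, hw, ?_⟩)
  rw [map_mul, ← hwr, QuotientGroup.eq]
  convert hle hr' using 1
  group

end Residual

end CosetDynamics

theorem mainTheorem1 {G : Type*} [Group G] [TopologicalSpace G] [IsTopologicalGroup G]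
    [T2Space G] [LocallyCompactSpace G] [TotallyDisconnectedSpace G]
    (H : Subgroup (G ≃ₜ* G)) (hH : CosetDynamics.IsEquicontinuouslyGenerated H)
    (K : Subgroup G) (hKclosed : IsClosed (K : Set G))
    (hK : CosetDynamics.IsInvariant H (K : Set G)) :
    List.TFAE [
      CosetDynamics.ActsNEquicontinuously hK,
      CosetDynamics.ActsNDistally hK,
      ∃ N ∈ 𝓝 ((1 : G) : G ⧸ K), ∀ x ∈ N, ∀ y ∈ N,
        IsCompact (closure (CosetDynamics.cosetOrbit hK x)) →
        x ∈ closure (CosetDynamics.cosetOrbit hK y) →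
        y ∈ closure (CosetDynamics.cosetOrbit hK x),
      (𝓝 ((1 : G) : G ⧸ K)).HasBasis
        (fun V : Subgroup G => IsOpen (V : Set G) ∧ CosetDynamics.IsInvariant H (V : Set G))
        (fun V => ((↑) : G → G ⧸ K) '' (V : Set G)),
      CosetDynamics.discreteResidual H ≤ K] := by
  tfae_have 1 → 2 := fun h => h.actsNDistally hKclosed
  tfae_have 2 → 3 := fun h => h.isNRecurrent hKclosed
  tfae_have 3 → 4 := fun h => CosetDynamics.hasBasis_iff_hasSmallInvariantSubgroups.2
    (CosetDynamics.IsNRecurrent.hasSmallInvariantSubgroups (hK := hK) hH hKclosed h)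
  tfae_have 4 → 5 := fun h =>
    (CosetDynamics.hasBasis_iff_hasSmallInvariantSubgroups.1 h).discreteResidual_le hKclosed
  -- Here recurrence and the resulting invariant subgroups concern `G ⧸ discreteResidual H`.
  tfae_have 5 → 1 := CosetDynamics.actsNEquicontinuously_of_discreteResidual_le hK
    ((CosetDynamics.isNRecurrent_discreteResidual H).hasSmallInvariantSubgroups hH
      (CosetDynamics.isClosed_discreteResidual H))
  tfae_finish
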